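/- Let $\mathbb F$ be a finite field and let $n,k,\delta$ be integers with $1\le k<n$, $\delta\ge 0$ and $(n-k)\mid\delta$. Put $\nu=\delta/(n-k)$ and $L=\lfloor \delta/k\rfloor+\delta/(n-k)$. Let $H(z)=\sum_{i=0}^{\nu}H_iz^i$ with $H_i\in\mathbb F^{(n-k)\times n}$, set $H_i=0$ for $i>\nu$, and let $$H_L^c=\begin{pmatrix}H_0&&&\\ H_1&H_0&&\\ \vdots&\vdots&\ddots&\\ H_L&H_{L-1}&\cdots&H_0\end{pmatrix}\in\mathbb F^{(L+1)(n-k)\times(L+1)n}.$$ Suppose that every full-size minor of $H_L^c$ that is not trivially zero is nonzero, that is, every minor formed by columns with indices $1\le t_1<\dots<t_{(L+1)(n-k)}\le (L+1)n$ such that $t_{s(n-k)}\le sn$ for $s=1,\dots,L$ is nonzero. Then $H(z)$ is left prime, i.e. whenever $H(z)=M(z)\bar H(z)$ with $M(z)\in\mathbb F[z]^{(n-k)\times(n-k)}$ and $\bar H(z)\in\mathbb F[z]^{(n-k)\times n}$, the matrix $M(z)$ is invertible over $\mathbb F[z]$. Moreover, $H(z)$ is a parity-check matrix of an $(n,k,\delta)$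 maximum distance profile (MDP) convolutional code $\mathcal C$, and the degree $\delta$ of $\mathcal C$ equals the sum of the row degrees of $H(z)$ (the $i$-th row degree is the largest degree of an entry of row $i$). Here an $(n,k,\delta)$ convolutional code is a submodule $\mathcal C\subseteq\mathbb F[z]^n$ of rank $k$ whose degree, the highest degree of the $k\times k$ minors of a matrix $G(z)\in\mathbb F[z]^{k\times n}$ whose rows form a basis of $\mathcal C$, is $\delta$. The matrix $H(z)$ is a parity-check matrix of $\mathcal C$ if for all $c(z)\in\mathbb F[z]^n$ one has $c(z)\in\mathcal C\Leftrightarrow H(z)c(z)^\top=0$. The $j$-th column distance of $\mathcal C$ is $$d_j^c=\min\Big\{\sum_{i=0}^{j}\mathrm{wt}(v_i)\ \Big|\ v(z)=\sum_i v_iz^i\in\mathcal C,\ v_0\neq0\Big\},$$ where $\mathrm{wt}$ is the Hamming weight on $\mathbb F^n$, and $\mathcal C$ is MDP if $d_j^c=(n-k)(j+1)+1$ for all $j=0,\dots,\lfloor\delta/k\rfloor+\lfloor\delta/(n-k)\rfloor$. -/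

import Mathlib

namespace ConvCode

open Polynomial

variable {F : Type*} [Field F]

/-- `H(z)` is left prime: in every factorization `H = M * H'` with `M` square, the left factor
`M` is unimodular. -/
def IsLeftPrime {m n : ℕ} (H : Matrix (Fin m) (Fin n) F[X]) : Prop :=
  ∀ (M : Matrix (Fin m) (Fin m) F[X]) (H' : Matrix (Fin m) (Fin n) F[X]), H = M * H' → IsUnit M

/-- The largest degree among the entries of the `i`-th row. -/
def rowDegree {m n : ℕ} (H : Matrix (Fin m) (Fin n) F[X]) (i : Fin m) : ℕ :=
  Finset.univ.sup fun l => (H i l).natDegree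

/-- The `j`-th truncated sliding parity-check matrix `H_j^c`, of size `(j+1)m × (j+1)n`: its block
in block row `a` and block column `b` is the coefficient matrix `H_{a-b}` if `b ≤ a`,
and `0` otherwise. -/
def slidingParityCheck {m n : ℕ} (H : Matrix (Fin m) (Fin n) F[X]) (j : ℕ) :
    Matrix (Fin ((j + 1) * m)) (Fin ((j + 1) * n)) F :=
  Matrix.of fun a b =>
    if (b.divNat : ℕ) ≤ (a.divNat : ℕ) then
      (H a.modNat b.modNat).coeff ((a.divNat : ℕ) - (b.divNat : ℕ))
    else 0

/-- The selection of columns of `H_j^c` with one-based indices `t_1 < t_2 < ⋯ < t_{(j+1)m}`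
gives a minor that is not trivially zero: `t_{s m} ≤ s n` for `s = 1, …, j`.
In the code both rows and columns are counted from `0`. -/
def NotTriviallyZero {m n j : ℕ} (t : Fin ((j + 1) * m) ↪o Fin ((j + 1) * n)) : Prop :=
  ∀ s : ℕ, 1 ≤ s → s ≤ j → ∀ i : Fin ((j + 1) * m), (i : ℕ) + 1 = s * m → (t i : ℕ) + 1 ≤ s * n

/-- Every full-size minor of `H_j^c` that is not trivially zero is nonzero. -/
def MinorCriterion {m n : ℕ} (H : Matrix (Fin m) (Fin n) F[X]) (j : ℕ) : Prop :=
  ∀ t : Fin ((j + 1) * m) ↪o Fin ((j + 1) * n), NotTriviallyZero t →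
    ((slidingParityCheck H j).submatrix id t).det ≠ 0

/-- The rows of `G(z)` form a basis of the code `C`. -/
def IsGeneratorMatrix {k n : ℕ} (G : Matrix (Fin k) (Fin n) F[X])
    (C : Submodule F[X] (Fin n → F[X])) : Prop :=
  LinearIndependent F[X] (fun i => G i) ∧ Submodule.span F[X] (Set.range fun i => G i) = C

/-- The highest degree of the full-size minors of `G(z)`. -/
noncomputable def maxMinorDegree {k n : ℕ} (G : Matrix (Fin k) (Fin n) F[X]) : ℕ :=
  Finset.univ.sup fun t : Fin k ↪o Fin n => (G.submatrix id t).det.natDegree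

/-- `C` is an `(n, k, δ)` convolutional code: a submodule of `F[z]^n` of rank `k` and of
degree `δ`, the degree being the highest degree of the `k × k` minors of a generator matrix
(a generator matrix exists, and the value is the same for all of them). -/
structure IsConvolutionalCode (n k δ : ℕ) (C : Submodule F[X] (Fin n → F[X])) : Prop where
  rank_eq : Module.finrank F[X] C = k
  exists_generator : ∃ G : Matrix (Fin k) (Fin n) F[X], IsGeneratorMatrix G C
  degree_eq : ∀ G : Matrix (Fin k) (Fin n) F[X], IsGeneratorMatrix G C → maxMinorDegree G = δ

/-- `H(z)` is a parity-check matrix of `C`: a vector `c(z)` lies in `C` iff `H(z) c(z)ᵀ = 0`. -/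
def IsParityCheckMatrix {m n : ℕ} (H : Matrix (Fin m) (Fin n) F[X])
    (C : Submodule F[X] (Fin n → F[X])) : Prop :=
  ∀ c : Fin n → F[X], c ∈ C ↔ H.mulVec c = 0

/-- The `i`-th coefficient vector `v_i ∈ F^n` of `v(z) = ∑ v_i z^i`. -/
def coeffVec {n : ℕ} (v : Fin n → F[X]) (i : ℕ) : Fin n → F :=
  fun l => (v l).coeff i

/-- The weight of the truncation `v_0 + v_1 z + ⋯ + v_j z^j`. -/
def truncWeight [DecidableEq F] {n : ℕ} (j : ℕ) (v : Fin n → F[X]) : ℕ :=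
  ∑ i ∈ Finset.range (j + 1), hammingNorm (coeffVec v i)

/-- The `j`-th column distance: the minimal weight of `v_0 + ⋯ + v_j z^j` over the codewords
`v(z)` with `v_0 ≠ 0`. (The infimum of a nonempty set of naturals is its minimum; it is `0` if
there is no such codeword.) -/
noncomputable def columnDistance [DecidableEq F] {n : ℕ} (C : Submodule F[X] (Fin n → F[X]))
    (j : ℕ) : ℕ :=
  sInf {w | ∃ v ∈ C, coeffVec v 0 ≠ 0 ∧ truncWeight j v = w}

/-- The `(n, k, δ)` convolutional code `C` is maximum distance profile:
`d_j^c = (n-k)(j+1)+1` for all `j = 0, …, L`, with `L = ⌊δ/k⌋ + ⌊δ/(n-k)⌋`. -/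
structure IsMDP [DecidableEq F] (n k δ : ℕ) (C : Submodule F[X] (Fin n → F[X])) : Prop where
  isCode : IsConvolutionalCode n k δ C
  columnDistance_eq : ∀ j ≤ δ / k + δ / (n - k), columnDistance C j = (n - k) * (j + 1) + 1

end ConvCode

/-!
The columns of `H_L^c` are pairs (block, position in the block), and a choice of columns gives a
minor that is not trivially zero iff the first `r` blocks contain at least `rm` of them, where
`m = n - k`, for all `r ≤ L`. By the minor criterion, a polynomial vector `c(z)` whose coefficients
of index at most `L` are supported on such a choice is determined by the coefficients of
`H(z) c(z)` of index at most `L`, and these can be prescribed arbitrarily.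

As `δ = mν`, the first `⌊δ/k⌋ + 1` blocks already contain such a choice, and degrees then match
exactly: every `y(z)` of degree at most `ν + ⌊δ/k⌋` is `H(z) c(z)` with `deg c ≤ ⌊δ/k⌋`. So `H` has
a right inverse, whence it is left prime, and the leading coefficient matrix `H_ν` is surjective,
whence all row degrees and the degree of some full-size minor are maximal. Complementary minors of
`H` and of a generator matrix of its kernel are associated, so the code has degree `mν`.

For the column distances, consider the first `j` at which the truncation of a codeword has weight at
most `m(j+1)`: its support extends to an admissible choice of columns, so the truncation vanishes.
The value `m(j+1)+1` is attained by starting from a unit vector and cancelling the coefficients of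
`H(z) c(z)` one after the other with `m` columns of `H_0`.
-/

namespace ConvCode

open Polynomial Matrix Finset

section MatrixAlgebra

variable {R S K ι κ μ : Type*} [CommRing R] [NonUnitalNonAssocSemiring S] [Field K] [Fintype κ]
  [Fintype μ]

theorem mulVec_eq_submatrix_mulVec_comp (A : Matrix ι κ S) {t : μ → κ} (ht : t.Injective)
    {x : κ → S} (hx : ∀ p ∉ Set.range t, x p = 0) : A *ᵥ x = A.submatrix id t *ᵥ (x ∘ t) := by
  ext i
  refine (Fintype.sum_of_injective t ht _ _ (fun p hp => ?_) fun q => rfl).symm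
  rw [hx p hp, mul_zero]

variable [Fintype ι]

theorem submatrix_inl_mul_add_submatrix_inr_mul {ρ τ : Type*} (A : Matrix ρ μ S)
    (B : Matrix μ τ S) (e : ι ⊕ κ ≃ μ) :
    A.submatrix id (e ∘ Sum.inl) * B.submatrix (e ∘ Sum.inl) id +
      A.submatrix id (e ∘ Sum.inr) * B.submatrix (e ∘ Sum.inr) id = A * B := by
  ext i j
  simp only [Matrix.add_apply, Matrix.mul_apply, submatrix_apply, id,
    ← e.sum_comp fun p => A i p * B p j, Fintype.sum_sum_type, Function.comp_apply]

theorem det_mul_det_fromBlocks_of_mul_eq_one_of_mul_eq_zero [DecidableEq ι] [DecidableEq κ]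
    {A : Matrix ι ι R} {B : Matrix ι κ R} {P : Matrix ι ι R} {Q : Matrix κ ι R}
    {U : Matrix ι κ R} {V : Matrix κ κ R} (hone : A * P + B * Q = 1) (hzero : A * U + B * V = 0) :
    A.det * (fromBlocks P U Q V).det = V.det := by
  have hmul : fromBlocks A B 0 1 * fromBlocks P U Q V = fromBlocks 1 0 Q V := by
    simp only [fromBlocks_multiply, hone, hzero, Matrix.zero_mul, Matrix.one_mul, zero_add]
  simpa only [det_mul, det_fromBlocks_zero₂₁, det_fromBlocks_zero₁₂, det_one, mul_one, one_mul]
    using congrArg det hmul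

theorem associated_det_submatrix_of_exact [DecidableEq ι] [DecidableEq κ] {H : Matrix ι μ R}
    {P : Matrix μ ι R} {G : Matrix κ μ R} (hP : H * P = 1)
    (hG : Function.Exact Gᵀ.mulVec H.mulVec) (e : ι ⊕ κ ≃ μ) :
    Associated (H.submatrix id (e ∘ Sum.inl)).det (G.submatrix id (e ∘ Sum.inr)).det := by
  have hHG : H * Gᵀ = 0 := ext_of_mulVec_single fun i => by
    rw [← mulVec_mulVec, zero_mulVec]
    exact hG.apply_apply_eq_zero _
  have hsurj : Function.Surjective (fromCols P Gᵀ).mulVec := fun c => by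
    obtain ⟨b, hb⟩ := (hG (c - P *ᵥ (H *ᵥ c))).1 (by
      rw [mulVec_sub, mulVec_mulVec, hP, one_mulVec, sub_self])
    refine ⟨Sum.elim (H *ᵥ c) b, ?_⟩
    rw [fromCols_mulVec_sumElim, hb, add_sub_cancel]
  have hunit : IsUnit ((fromCols P Gᵀ).submatrix e id).det := by
    rw [← isUnit_iff_isUnit_det, ← mulVec_surjective_iff_isUnit]
    intro c
    obtain ⟨w, hw⟩ := hsurj (c ∘ e.symm)
    exact ⟨w, funext fun q => (congrFun hw (e q)).trans (congrArg c (e.symm_apply_apply q))⟩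
  have hblocks : (fromCols P Gᵀ).submatrix e id =
      fromBlocks (P.submatrix (e ∘ Sum.inl) id) (Gᵀ.submatrix (e ∘ Sum.inl) id)
        (P.submatrix (e ∘ Sum.inr) id) (Gᵀ.submatrix (e ∘ Sum.inr) id) := by
    ext (i | i) (j | j) <;> rfl
  have hdet := det_mul_det_fromBlocks_of_mul_eq_one_of_mul_eq_zero
    ((submatrix_inl_mul_add_submatrix_inr_mul H P e).trans hP)
    ((submatrix_inl_mul_add_submatrix_inr_mul H Gᵀ e).trans hHG)
  rw [← hblocks, ← transpose_submatrix, det_transpose] at hdet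
  exact ⟨hunit.unit, hdet⟩

theorem exists_injective_isUnit_submatrix [DecidableEq ι] {A : Matrix ι κ K}
    (hA : Function.Surjective A.mulVec) :
    ∃ f : ι → κ, f.Injective ∧ IsUnit (A.submatrix id f) := by
  have hspan : Submodule.span K (Set.range A.col) = ⊤ := by
    rw [← range_mulVecLin, LinearMap.range_eq_top]
    exact hA
  have hcols := Submodule.exists_fun_fin_finrank_span_eq K (Set.range A.col)
  rw [hspan, finrank_top, Module.finrank_fintype_fun_eq_card] at hcols
  obtain ⟨b, hb, -, hli⟩ := hcols
  choose f hf using hb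
  have hcol : (A.submatrix id (f ∘ Fintype.equivFin ι)).col = b ∘ Fintype.equivFin ι :=
    funext fun i => hf _
  have hlicol := hli.comp _ (Fintype.equivFin ι).injective
  rw [← hcol] at hlicol
  exact ⟨f ∘ Fintype.equivFin ι, .of_comp (f := A.col) hlicol.injective,
    linearIndependent_cols_iff_isUnit.1 hlicol⟩

theorem natDegree_det_le [DecidableEq ι] {A : Matrix ι ι R[X]} {ν : ℕ}
    (hA : ∀ i j, (A i j).natDegree ≤ ν) : A.det.natDegree ≤ Fintype.card ι * ν := by
  rw [det_apply]
  refine natDegree_sum_le_of_forall_le _ _ fun σ _ => (natDegree_smul_le _ _).trans ?_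
  exact (natDegree_prod_le _ _).trans (sum_le_card_nsmul _ _ _ fun i _ => hA _ _)

theorem coeff_det_of_natDegree_le [DecidableEq ι] {A : Matrix ι ι R[X]} {ν : ℕ}
    (hA : ∀ i j, (A i j).natDegree ≤ ν) :
    A.det.coeff (Fintype.card ι * ν) = (A.map (coeff · ν)).det := by
  simp only [det_apply, finsetSum_coeff, coeff_smul, map_apply]
  refine sum_congr rfl fun σ _ => congrArg (Equiv.Perm.sign σ • ·) ?_
  exact coeff_prod_of_natDegree_le (s := univ) (fun i => A (σ i) i) ν fun i _ => hA _ _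

theorem finrank_ker_mulVecLin_add_card [IsDomain R] {H : Matrix ι μ R}
    (hH : Function.Surjective H.mulVec) :
    Module.finrank R H.mulVecLin.ker + Fintype.card ι = Fintype.card μ := by
  have hquot := H.mulVecLin.ker.finrank_quotient_add_finrank
  rwa [(H.mulVecLin.quotKerEquivOfSurjective hH).finrank_eq, Module.finrank_fintype_fun_eq_card,
    Module.finrank_fintype_fun_eq_card, add_comm] at hquot

end MatrixAlgebra

section CoefficientVectors

variable {F : Type*} [Field F] {m n : ℕ}

/-- The coefficient matrix `H_i` of `H(z) = ∑ H_i z^i`. -/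
def coeffMatrix (H : Matrix (Fin m) (Fin n) F[X]) (i : ℕ) : Matrix (Fin m) (Fin n) F :=
  H.map (coeff · i)

theorem coeffVec_add (c g : Fin n → F[X]) (a : ℕ) :
    coeffVec (c + g) a = coeffVec c a + coeffVec g a :=
  funext fun _ => coeff_add _ _ _

theorem coeffVec_X_pow_smul (N : ℕ) (c : Fin n → F[X]) (a : ℕ) :
    coeffVec ((X : F[X]) ^ N • c) a = if N ≤ a then coeffVec c (a - N) else 0 := by
  ext l
  simp only [coeffVec, Pi.smul_apply, smul_eq_mul, coeff_X_pow_mul', ite_apply, Pi.zero_apply]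

theorem coeffVec_C (w : Fin n → F) (a : ℕ) :
    coeffVec (fun l => C (w l)) a = if a = 0 then w else 0 := by
  ext l
  simp only [coeffVec, coeff_C, ite_apply, Pi.zero_apply]

theorem exists_coeffVec_eq_ite (x : ℕ → Fin n → F) (N : ℕ) :
    ∃ c : Fin n → F[X], ∀ b, coeffVec c b = if b < N then x b else 0 := by
  refine ⟨fun l => ∑ b ∈ range N, monomial b (x b l), fun b => funext fun l => ?_⟩
  simp only [coeffVec, finsetSum_coeff, coeff_monomial, sum_ite_eq', mem_range, ite_apply,
    Pi.zero_apply]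

theorem coeffVec_mulVec (H : Matrix (Fin m) (Fin n) F[X]) (c : Fin n → F[X]) (a : ℕ) :
    coeffVec (H *ᵥ c) a = ∑ p ∈ antidiagonal a, coeffMatrix H p.1 *ᵥ coeffVec c p.2 := by
  ext i
  simp only [coeffVec, mulVec, dotProduct, finsetSum_coeff, coeff_mul, Finset.sum_apply,
    coeffMatrix, map_apply]
  exact sum_comm

theorem coeffVec_mulVec_zero (H : Matrix (Fin m) (Fin n) F[X]) (c : Fin n → F[X]) :
    coeffVec (H *ᵥ c) 0 = coeffMatrix H 0 *ᵥ coeffVec c 0 := by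
  rw [coeffVec_mulVec, Finset.Nat.antidiagonal_zero, sum_singleton]

theorem coeffVec_mulVec_congr (H : Matrix (Fin m) (Fin n) F[X]) {c c' : Fin n → F[X]} {a : ℕ}
    (h : ∀ b ≤ a, coeffVec c b = coeffVec c' b) :
    coeffVec (H *ᵥ c) a = coeffVec (H *ᵥ c') a := by
  rw [coeffVec_mulVec, coeffVec_mulVec]
  exact sum_congr rfl fun p hp => by rw [h p.2 (mem_antidiagonal.1 hp ▸ Nat.le_add_left _ _)]

theorem natDegree_mulVec_le {H : Matrix (Fin m) (Fin n) F[X]} {c : Fin n → F[X]} {ν d : ℕ}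
    (hH : ∀ i l, (H i l).natDegree ≤ ν) (hc : ∀ l, (c l).natDegree ≤ d) (i : Fin m) :
    ((H *ᵥ c) i).natDegree ≤ ν + d :=
  natDegree_sum_le_of_forall_le univ (fun l => H i l * c l) fun l _ =>
    natDegree_mul_le_of_le (hH i l) (hc l)

theorem coeffVec_mulVec_add {H : Matrix (Fin m) (Fin n) F[X]} {c : Fin n → F[X]} {ν d : ℕ}
    (hH : ∀ i l, (H i l).natDegree ≤ ν) (hc : ∀ l, (c l).natDegree ≤ d) :
    coeffVec (H *ᵥ c) (ν + d) = coeffMatrix H ν *ᵥ coeffVec c d := by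
  ext i
  simp only [coeffVec, mulVec, dotProduct, finsetSum_coeff, coeffMatrix, map_apply]
  exact sum_congr rfl fun l _ => coeff_mul_add_eq_of_natDegree_le (hH i l) (hc l)

/-- The support of `c(z) = ∑ c_b z^b`, as the set of pairs `(b, l)` for which the `l`-th entry of
`c_b` is nonzero. -/
noncomputable def coeffSupport (c : Fin n → F[X]) : Finset (ℕ × Fin n) :=
  univ.biUnion fun l => (c l).support ×ˢ {l}

theorem mem_coeffSupport {c : Fin n → F[X]} {p : ℕ × Fin n} :
    p ∈ coeffSupport c ↔ coeffVec c p.1 p.2 ≠ 0 := by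
  simp [coeffSupport, coeffVec, ← and_assoc, Prod.ext_iff]

theorem notMem_coeffSupport {c : Fin n → F[X]} {p : ℕ × Fin n} :
    p ∉ coeffSupport c ↔ coeffVec c p.1 p.2 = 0 := by
  rw [mem_coeffSupport, not_not]

theorem coeffSupport_add_subset (c g : Fin n → F[X]) :
    coeffSupport (c + g) ⊆ coeffSupport c ∪ coeffSupport g := fun p => by
  contrapose!
  intro hp
  rw [notMem_union, notMem_coeffSupport, notMem_coeffSupport] at hp
  rw [notMem_coeffSupport, coeffVec_add, Pi.add_apply, hp.1, hp.2, add_zero]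

theorem exists_coeffSupport_eq_filter (v : Fin n → F[X]) (N : ℕ) :
    ∃ c : Fin n → F[X], coeffSupport c = {p ∈ coeffSupport v | p.1 < N} ∧
      ∀ b < N, coeffVec c b = coeffVec v b := by
  obtain ⟨c, hc⟩ := exists_coeffVec_eq_ite (coeffVec v) N
  refine ⟨c, Finset.ext fun p => ?_, fun b hb => (hc b).trans (if_pos hb)⟩
  rw [mem_filter, mem_coeffSupport, mem_coeffSupport, hc, ite_apply, Pi.zero_apply, and_comm]
  exact ite_ne_right_iff

theorem truncWeight_eq_card_filter [DecidableEq F] (j : ℕ) (c : Fin n → F[X]) :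
    truncWeight j c = #{p ∈ coeffSupport c | p.1 < j + 1} := by
  have hfilter : {p ∈ coeffSupport c | p.1 < j + 1} =
      {p ∈ range (j + 1) ×ˢ (univ : Finset (Fin n)) | coeffVec c p.1 p.2 ≠ 0} := by
    ext p
    simp only [mem_filter, mem_coeffSupport, mem_product, mem_range, mem_univ, and_true]
    exact and_comm
  simp only [hfilter, truncWeight, hammingNorm, card_filter, sum_product]

end CoefficientVectors

section SlidingMatrix

variable {F : Type*} [Field F] {m n : ℕ}

/-- Splits the row or column index of a matrix made of blocks of size `n` into the number of its
block and its position inside that block. -/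
def blockIndex {N n : ℕ} : Fin (N * n) ↪ ℕ × Fin n :=
  finProdFinEquiv.symm.toEmbedding.trans (Fin.valEmbedding.prodMap (.refl (Fin n)))

theorem mem_range_blockIndex {N : ℕ} {p : ℕ × Fin n} :
    p ∈ Set.range (blockIndex (N := N) (n := n)) ↔ p.1 < N := by
  refine ⟨?_, fun hp => ⟨finProdFinEquiv (⟨p.1, hp⟩, p.2), ?_⟩⟩
  · rintro ⟨q, rfl⟩
    exact q.divNat.isLt
  · simp [blockIndex]

theorem blockIndex_fst_lt_iff {N r : ℕ} {p : Fin (N * n)} :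
    (blockIndex p).1 < r ↔ (p : ℕ) < r * n :=
  Nat.div_lt_iff_lt_mul p.modNat.pos

theorem map_univ_blockIndex (N n : ℕ) :
    univ.map (blockIndex (N := N) (n := n)) = range N ×ˢ univ := by
  ext p
  simp only [mem_map, mem_univ, true_and, ← Set.mem_range, mem_range_blockIndex, mem_product,
    and_true, mem_range]

/-- The column vector `(c_0, …, c_j)` on which `slidingParityCheck H j` acts. -/
def slidingVec (j : ℕ) (c : Fin n → F[X]) : Fin ((j + 1) * n) → F :=
  fun p => coeffVec c (blockIndex p).1 (blockIndex p).2

theorem sum_antidiagonal_eq_sum_range_ite {M : Type*} [AddCommMonoid M] (f : ℕ → ℕ → M) {a N : ℕ}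
    (ha : a < N) :
    ∑ p ∈ antidiagonal a, f p.1 p.2 = ∑ b ∈ range N, if b ≤ a then f (a - b) b else 0 := by
  rw [← sum_filter, ← Finset.Nat.sum_antidiagonal_swap,
    Finset.Nat.sum_antidiagonal_eq_sum_range_succ_mk]
  refine sum_congr (Finset.ext fun b => ?_) fun _ _ => rfl
  simp only [mem_range, mem_filter]
  omega

theorem slidingParityCheck_mulVec (H : Matrix (Fin m) (Fin n) F[X]) (j : ℕ) (c : Fin n → F[X]) :
    slidingParityCheck H j *ᵥ slidingVec j c = slidingVec j (H *ᵥ c) := by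
  ext p
  let a := (blockIndex p).1
  let i := (blockIndex p).2
  have ha : a < j + 1 := mem_range_blockIndex.1 (Set.mem_range_self p)
  calc ∑ q, slidingParityCheck H j p q * slidingVec j c q
      = ∑ b ∈ range (j + 1), ∑ l,
          (if b ≤ a then coeffMatrix H (a - b) i l else 0) * coeffVec c b l := by
        rw [← sum_product', ← map_univ_blockIndex, sum_map]
        rfl
    _ = ∑ b ∈ range (j + 1), if b ≤ a then (coeffMatrix H (a - b) *ᵥ coeffVec c b) i else 0 := by
        refine sum_congr rfl fun b _ => ?_
        split_ifs
        · rfl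
        · simp only [zero_mul, sum_const_zero]
    _ = ∑ p ∈ antidiagonal a, (coeffMatrix H p.1 *ᵥ coeffVec c p.2) i :=
        (sum_antidiagonal_eq_sum_range_ite
          (fun e b => (coeffMatrix H e *ᵥ coeffVec c b) i) ha).symm
    _ = coeffVec (H *ᵥ c) a i := by rw [coeffVec_mulVec, Finset.sum_apply]

theorem slidingVec_eq_iff {j : ℕ} {c c' : Fin n → F[X]} :
    slidingVec j c = slidingVec j c' ↔ ∀ b < j + 1, coeffVec c b = coeffVec c' b := by
  refine ⟨fun h b hb => funext fun l => ?_, fun h => funext fun p => ?_⟩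
  · obtain ⟨p, hp⟩ := (mem_range_blockIndex (p := (b, l))).2 hb
    have hcp := congrFun h p
    simpa only [slidingVec, hp] using hcp
  · exact congrFun (h _ (mem_range_blockIndex.1 (Set.mem_range_self p))) _

end SlidingMatrix

section AdmissibleColumns

variable {F : Type*} [Field F] {m n : ℕ}

/-- A set of columns, each given by its block and its position inside the block, selecting a
full-size minor with `N` block rows of height `m` that is not trivially zero. -/
structure IsAdmissible (m N : ℕ) (T : Finset (ℕ × Fin n)) : Prop where
  subset : T ⊆ range N ×ˢ univ
  card_eq : #T = N * m
  le_card_filter : ∀ r < N, r * m ≤ #{p ∈ T | p.1 < r}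

theorem IsAdmissible.fst_lt {T : Finset (ℕ × Fin n)} {N : ℕ} (hT : IsAdmissible m N T)
    {p : ℕ × Fin n} (hp : p ∈ T) : p.1 < N :=
  mem_range.1 (mem_product.1 (hT.subset hp)).1

theorem isAdmissible_of_product_subset {T : Finset (ℕ × Fin n)} {s : Finset (Fin n)} {d N : ℕ}
    (hsub : range d ×ˢ s ⊆ T) (hT : T ⊆ range d ×ˢ univ) (hd : d ≤ N) (hcard : #T = N * #s) :
    IsAdmissible #s N T where
  subset := hT.trans (product_subset_product_left (range_subset_range.2 hd))
  card_eq := hcard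
  le_card_filter r hr := by
    rcases le_total r d with hrd | hdr
    · have hprod : #(range r ×ˢ s) = r * #s := by rw [card_product, card_range]
      rw [← hprod]
      refine card_le_card fun p hp => ?_
      have hpr := mem_product.1 hp
      exact mem_filter.2 ⟨hsub (product_subset_product_left (range_subset_range.2 hrd) hp),
        mem_range.1 hpr.1⟩
    · rw [filter_true_of_mem fun p hp => (mem_range.1 (mem_product.1 (hT hp)).1).trans_le hdr,
        hcard]
      exact Nat.mul_le_mul_right _ hr.le

theorem exists_isAdmissible_subset_range_product {d N : ℕ} (hd : d ≤ N) (hd0 : 0 < d)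
    (hle : N * m ≤ d * n) :
    ∃ T : Finset (ℕ × Fin n), IsAdmissible m N T ∧ T ⊆ range d ×ˢ univ := by
  have hmn : m ≤ n := Nat.le_of_mul_le_mul_left ((Nat.mul_le_mul_right m hd).trans hle) hd0
  obtain ⟨s, -, rfl⟩ := exists_subset_card_eq (s := (univ : Finset (Fin n))) (by simpa using hmn)
  obtain ⟨T, hsub, hT, hcard⟩ := exists_subsuperset_card_eq (n := N * #s)
    (product_subset_product_right (s := range d) (subset_univ s))
    (by rw [card_product, card_range]; exact Nat.mul_le_mul_right _ hd)
    (by rwa [card_product, card_range, card_univ, Fintype.card_fin])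
  exact ⟨T, isAdmissible_of_product_subset hsub hT hd hcard, hT⟩

theorem exists_isAdmissible_of_truncWeight_le [DecidableEq F] {v : Fin n → F[X]} {j : ℕ}
    (hmn : m ≤ n) (hle : truncWeight j v ≤ m * (j + 1))
    (hlow : ∀ i < j, m * (i + 1) ≤ truncWeight i v) :
    ∃ T : Finset (ℕ × Fin n), IsAdmissible m (j + 1) T ∧
      {p ∈ coeffSupport v | p.1 < j + 1} ⊆ T := by
  rw [truncWeight_eq_card_filter, mul_comm] at hle
  have hsub : {p ∈ coeffSupport v | p.1 < j + 1} ⊆ range (j + 1) ×ˢ univ := fun p hp =>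
    mem_product.2 ⟨mem_range.2 (mem_filter.1 hp).2, mem_univ _⟩
  obtain ⟨T, hST, hT, hcard⟩ := exists_subsuperset_card_eq hsub hle
    (by rw [card_product, card_range, card_univ, Fintype.card_fin]; exact Nat.mul_le_mul_left _ hmn)
  refine ⟨T, ⟨hT, hcard, ?_⟩, hST⟩
  rintro (_ | i) hi
  · simp only [zero_mul, zero_le]
  · have hi' : i < j := Nat.lt_of_succ_lt_succ hi
    rw [mul_comm]
    refine (hlow i hi').trans ?_
    rw [truncWeight_eq_card_filter]
    refine card_le_card fun p hp => ?_
    obtain ⟨hpv, hpi⟩ := mem_filter.1 hp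
    exact mem_filter.2 ⟨hST (mem_filter.2 ⟨hpv, hpi.trans hi⟩), hpi⟩

theorem IsAdmissible.union_Ico_product {T : Finset (ℕ × Fin n)} {s : Finset (Fin n)} {N M : ℕ}
    (hT : IsAdmissible #s N T) (hNM : N ≤ M) : IsAdmissible #s M (T ∪ Ico N M ×ˢ s) := by
  have hcard {r : ℕ} (hr : N ≤ r) : #(T ∪ Ico N r ×ˢ s) = r * #s := by
    rw [card_union_of_disjoint, hT.card_eq, card_product, Nat.card_Ico, ← add_mul,
      Nat.add_sub_cancel' hr]
    refine disjoint_left.2 fun p hp hps => (hT.fst_lt hp).not_ge ?_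
    exact (mem_Ico.1 (mem_product.1 hps).1).1
  refine ⟨union_subset (hT.subset.trans ?_) ?_, hcard hNM, fun r hr => ?_⟩
  · exact product_subset_product_left (range_subset_range.2 hNM)
  · exact product_subset_product (fun b hb => mem_range.2 (mem_Ico.1 hb).2) (subset_univ s)
  rcases lt_or_ge r N with hrN | hNr
  · exact (hT.le_card_filter r hrN).trans
      (card_le_card (filter_subset_filter _ subset_union_left))
  · rw [← hcard hNr]
    refine card_le_card fun p hp => ?_
    simp only [mem_union, mem_product, mem_Ico, mem_filter] at hp ⊢
    rcases hp with hp | ⟨⟨hNp, hpr⟩, hps⟩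
    · exact ⟨.inl hp, (hT.fst_lt hp).trans_le hNr⟩
    · exact ⟨.inr ⟨⟨hNp, hpr.trans hr⟩, hps⟩, hpr⟩

theorem IsAdmissible.exists_notTriviallyZero {T : Finset (ℕ × Fin n)} {j : ℕ}
    (hT : IsAdmissible m (j + 1) T) :
    ∃ t : Fin ((j + 1) * m) ↪o Fin ((j + 1) * n), NotTriviallyZero t ∧
      ∀ p, p ∈ Set.range t ↔ blockIndex p ∈ T := by
  let S : Finset (Fin ((j + 1) * n)) := {p | blockIndex p ∈ T}
  have hmap : S.map blockIndex = T := by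
    ext p
    simp only [S, mem_map, mem_filter_univ]
    refine ⟨fun ⟨_, hq, hqp⟩ => hqp ▸ hq, fun hp => ?_⟩
    obtain ⟨q, rfl⟩ := mem_range_blockIndex.2 (hT.fst_lt hp)
    exact ⟨q, hp, rfl⟩
  have hcard : #S = (j + 1) * m := by rw [← card_map blockIndex, hmap, hT.card_eq]
  have hrange (p) : p ∈ Set.range (S.orderEmbOfFin hcard) ↔ blockIndex p ∈ T := by
    rw [range_orderEmbOfFin, mem_coe, mem_filter_univ]
  refine ⟨S.orderEmbOfFin hcard, fun r _ hr i hi => ?_, hrange⟩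
  by_contra! hlt
  have hsub : {p ∈ T | p.1 < r} ⊆ (Iio i).image (blockIndex ∘ S.orderEmbOfFin hcard) := by
    intro p hp
    obtain ⟨hpT, hpr⟩ := mem_filter.1 hp
    obtain ⟨q, rfl⟩ := mem_range_blockIndex.2 (hT.fst_lt hpT)
    obtain ⟨i', rfl⟩ := (hrange q).2 hpT
    refine mem_image.2 ⟨i', mem_Iio.2 ((S.orderEmbOfFin hcard).lt_iff_lt.1 ?_), rfl⟩
    exact (blockIndex_fst_lt_iff.1 hpr).trans_le (Nat.lt_succ_iff.1 hlt)
  have hle := (hT.le_card_filter r (by omega)).trans ((card_le_card hsub).trans card_image_le)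
  rw [Fin.card_Iio] at hle
  omega

end AdmissibleColumns

section MinorCriterion

variable {F : Type*} [Field F] {m n : ℕ} {H : Matrix (Fin m) (Fin n) F[X]}

theorem MinorCriterion.exists_isUnit_submatrix {L : ℕ} (hH : MinorCriterion H L)
    {T : Finset (ℕ × Fin n)} (hT : IsAdmissible m (L + 1) T) :
    ∃ t : Fin ((L + 1) * m) → Fin ((L + 1) * n), t.Injective ∧
      (∀ p, p ∈ Set.range t ↔ blockIndex p ∈ T) ∧
        IsUnit ((slidingParityCheck H L).submatrix id t) := by
  obtain ⟨t, ht, hrange⟩ := hT.exists_notTriviallyZero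
  exact ⟨t, t.injective, hrange, (isUnit_iff_isUnit_det _).2 (isUnit_iff_ne_zero.2 (hH t ht))⟩

theorem MinorCriterion.eq_zero_of_coeffSupport_subset {L : ℕ} (hH : MinorCriterion H L)
    {T : Finset (ℕ × Fin n)} (hT : IsAdmissible m (L + 1) T) {c : Fin n → F[X]}
    (hcT : coeffSupport c ⊆ T) (hc : ∀ a < L + 1, coeffVec (H *ᵥ c) a = 0) : c = 0 := by
  obtain ⟨t, htinj, ht, hunit⟩ := hH.exists_isUnit_submatrix hT
  have hoff : ∀ p ∉ Set.range t, slidingVec L c p = 0 := fun p hp => by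
    by_contra hne
    exact hp ((ht p).2 (hcT (mem_coeffSupport.2 hne)))
  have hzero : (slidingParityCheck H L).submatrix id t *ᵥ (slidingVec L c ∘ t) = 0 := by
    rw [← mulVec_eq_submatrix_mulVec_comp _ htinj hoff, slidingParityCheck_mulVec]
    exact slidingVec_eq_iff (c' := 0).2 hc
  have hcomp : slidingVec L c ∘ t = 0 :=
    mulVec_injective_of_isUnit hunit (hzero.trans (mulVec_zero _).symm)
  have hsupp (p) : p ∉ coeffSupport c := fun hp => by
    obtain ⟨q, rfl⟩ := mem_range_blockIndex.2 (hT.fst_lt (hcT hp))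
    obtain ⟨r, rfl⟩ := (ht q).2 (hcT hp)
    exact mem_coeffSupport.1 hp (congrFun hcomp r)
  exact funext fun l => Polynomial.ext fun b => not_not.1 (mem_coeffSupport.not.1 (hsupp (b, l)))

theorem MinorCriterion.exists_coeffSupport_subset {L : ℕ} (hH : MinorCriterion H L)
    {T : Finset (ℕ × Fin n)} (hT : IsAdmissible m (L + 1) T) (y : Fin m → F[X]) :
    ∃ c : Fin n → F[X], coeffSupport c ⊆ T ∧
      ∀ a < L + 1, coeffVec (H *ᵥ c) a = coeffVec y a := by
  obtain ⟨t, htinj, ht, hunit⟩ := hH.exists_isUnit_submatrix hT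
  obtain ⟨z, hz⟩ := mulVec_surjective_iff_isUnit.2 hunit (slidingVec L y)
  have hinj : (blockIndex ∘ t).Injective := blockIndex.injective.comp htinj
  let x := Function.extend (blockIndex ∘ t) z 0
  obtain ⟨c, hc⟩ := exists_coeffVec_eq_ite (fun b l => x (b, l)) (L + 1)
  have hx {p} (hp : p ∉ T) : x p = 0 := Function.extend_apply' _ _ _ fun ⟨r, hr⟩ =>
    hp (hr ▸ (ht _).1 (Set.mem_range_self r))
  have hcx : slidingVec L c = x ∘ blockIndex := funext fun p => by
    rw [slidingVec, hc, if_pos (mem_range_blockIndex.1 (Set.mem_range_self p))]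
    rfl
  refine ⟨c, fun p hp => ?_, slidingVec_eq_iff.1 ?_⟩
  · by_contra hpT
    refine mem_coeffSupport.1 hp ?_
    rw [hc, ite_apply, hx hpT, Pi.zero_apply, ite_self]
  · rw [← slidingParityCheck_mulVec, mulVec_eq_submatrix_mulVec_comp _ htinj, hcx,
      Function.comp_assoc, Function.extend_comp hinj, hz]
    intro p hp
    rw [hcx]
    exact hx fun hpT => hp ((ht p).2 hpT)

theorem MinorCriterion.exists_mulVec_eq {d ν : ℕ} (hH : MinorCriterion H (d + ν))
    (hdeg : ∀ i l, (H i l).natDegree ≤ ν) (hle : (d + ν + 1) * m ≤ (d + 1) * n)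
    {y : Fin m → F[X]} (hy : ∀ i, (y i).natDegree ≤ ν + d) :
    ∃ c : Fin n → F[X], (∀ l, (c l).natDegree ≤ d) ∧ H *ᵥ c = y := by
  obtain ⟨T, hT, hTd⟩ := exists_isAdmissible_subset_range_product (by omega) d.succ_pos hle
  obtain ⟨c, hcT, hc⟩ := hH.exists_coeffSupport_subset hT y
  have hcd : ∀ l, (c l).natDegree ≤ d := fun l => natDegree_le_iff_coeff_eq_zero.2 fun b hb => by
    by_contra hne
    have hmem := hTd (hcT (mem_coeffSupport (p := (b, l)).2 hne))
    exact (mem_range.1 (mem_product.1 hmem).1).not_ge hb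
  refine ⟨c, hcd, funext fun i => Polynomial.ext fun a => ?_⟩
  rcases lt_or_ge a (d + ν + 1) with ha | ha
  · exact congrFun (hc a ha) i
  · rw [coeff_eq_zero_of_natDegree_lt ((natDegree_mulVec_le hdeg hcd i).trans_lt (by omega)),
      coeff_eq_zero_of_natDegree_lt ((hy i).trans_lt (by omega))]

theorem MinorCriterion.exists_right_inverse {d ν : ℕ} (hH : MinorCriterion H (d + ν))
    (hdeg : ∀ i l, (H i l).natDegree ≤ ν) (hle : (d + ν + 1) * m ≤ (d + 1) * n) :
    ∃ R : Matrix (Fin n) (Fin m) F[X], H * R = 1 := by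
  have hcol (r : Fin m) : ∃ c, H *ᵥ c = Pi.single r 1 := by
    obtain ⟨c, -, hc⟩ := hH.exists_mulVec_eq hdeg hle (y := Pi.single r 1) fun i => by
      rcases eq_or_ne i r with rfl | hir
      · simp only [Pi.single_eq_same, natDegree_one, zero_le]
      · simp only [Pi.single_eq_of_ne hir, natDegree_zero, zero_le]
    exact ⟨c, hc⟩
  choose c hc using hcol
  refine ⟨(of c)ᵀ, ext_of_mulVec_single fun r => ?_⟩
  rw [← mulVec_mulVec, mulVec_single_one, one_mulVec]
  exact hc r

theorem MinorCriterion.coeffMatrix_mulVec_surjective {d ν : ℕ} (hH : MinorCriterion H (d + ν))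
    (hdeg : ∀ i l, (H i l).natDegree ≤ ν) (hle : (d + ν + 1) * m ≤ (d + 1) * n) :
    Function.Surjective (coeffMatrix H ν).mulVec := fun u => by
  obtain ⟨c, hcd, hc⟩ := hH.exists_mulVec_eq hdeg hle (y := fun i => monomial (ν + d) (u i))
    fun i => natDegree_monomial_le _
  refine ⟨coeffVec c d, ?_⟩
  rw [← coeffVec_mulVec_add hdeg hcd, hc]
  exact funext fun i => coeff_monomial_same _ _

theorem MinorCriterion.exists_coeffMatrix_zero_mulVec_eq {L : ℕ} (hH : MinorCriterion H L)
    {s : Finset (Fin n)} (hs : #s = m) (u : Fin m → F) :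
    ∃ w : Fin n → F, (∀ l ∉ s, w l = 0) ∧ coeffMatrix H 0 *ᵥ w = u := by
  subst hs
  have hT : IsAdmissible #s (L + 1) (range (L + 1) ×ˢ s) :=
    isAdmissible_of_product_subset subset_rfl (product_subset_product_right (subset_univ s)) le_rfl
      (by rw [card_product, card_range])
  obtain ⟨c, hcT, hc⟩ := hH.exists_coeffSupport_subset hT fun i => C (u i)
  refine ⟨coeffVec c 0, fun l hl => ?_, ?_⟩
  · by_contra hne
    exact hl (mem_product.1 (hcT (mem_coeffSupport (p := (0, l)).2 hne))).2
  · rw [← coeffVec_mulVec_zero, hc 0 L.succ_pos]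
    exact funext fun i => coeff_C_zero

end MinorCriterion

section ColumnDistance

variable {F : Type*} [Field F] {m n : ℕ} {H : Matrix (Fin m) (Fin n) F[X]}

theorem coeffSupport_X_pow_smul_C_subset {s : Finset (Fin n)} {w : Fin n → F}
    (hw : ∀ l ∉ s, w l = 0) (N : ℕ) :
    coeffSupport ((X : F[X]) ^ N • fun l => C (w l)) ⊆ {N} ×ˢ s := fun p => by
  contrapose!
  intro hp
  rw [mem_product, mem_singleton, not_and'] at hp
  rw [notMem_coeffSupport, coeffVec_X_pow_smul, coeffVec_C]
  split_ifs with hle heq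
  · exact hw _ fun hps => hp hps (by omega)
  · rfl
  · rfl

theorem exists_coeffVec_mulVec_add_eq_zero {s : Finset (Fin n)}
    (hs : ∀ u : Fin m → F, ∃ w, (∀ l ∉ s, w l = 0) ∧ coeffMatrix H 0 *ᵥ w = u)
    {c : Fin n → F[X]} {N M : ℕ} (hNM : N ≤ M) (hc : ∀ a < N, coeffVec (H *ᵥ c) a = 0) :
    ∃ g : Fin n → F[X], coeffSupport g ⊆ Ico N M ×ˢ s ∧
      ∀ a < M, coeffVec (H *ᵥ (c + g)) a = 0 := by
  induction M, hNM using Nat.le_induction with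
  | base => exact ⟨0, fun p hp => (mem_coeffSupport.1 hp rfl).elim, by rwa [add_zero]⟩
  | succ M hNM ih =>
    obtain ⟨g, hg, hcg⟩ := ih
    obtain ⟨w, hws, hw⟩ := hs (-coeffVec (H *ᵥ (c + g)) M)
    refine ⟨g + (X : F[X]) ^ M • fun l => C (w l), ?_, fun a ha => ?_⟩
    · refine (coeffSupport_add_subset _ _).trans (union_subset (hg.trans ?_)
        ((coeffSupport_X_pow_smul_C_subset hws M).trans ?_))
      · exact product_subset_product_left (Ico_subset_Ico_right M.le_succ)
      · exact product_subset_product_left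
          (singleton_subset_iff.2 (mem_Ico.2 ⟨hNM, M.lt_succ_self⟩))
    · rw [← add_assoc, mulVec_add, mulVec_smul, coeffVec_add, coeffVec_X_pow_smul]
      rcases (Nat.lt_succ_iff.1 ha).lt_or_eq with ha | rfl
      · rw [hcg a ha, if_neg ha.not_ge, add_zero]
      · rw [if_pos le_rfl, Nat.sub_self, coeffVec_mulVec_zero, coeffVec_C, if_pos rfl, hw,
          add_neg_cancel]

theorem exists_mulVec_eq_zero_coeffVec_eq {R : Matrix (Fin n) (Fin m) F[X]} (hR : H * R = 1)
    {c : Fin n → F[X]} {N : ℕ} (hc : ∀ a < N, coeffVec (H *ᵥ c) a = 0) :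
    ∃ v : Fin n → F[X], H *ᵥ v = 0 ∧ ∀ a < N, coeffVec v a = coeffVec c a := by
  refine ⟨c + R *ᵥ -(H *ᵥ c), ?_, fun a ha => ?_⟩
  · rw [mulVec_add, mulVec_mulVec, hR, one_mulVec, add_neg_cancel]
  · have hlow : coeffVec (R *ᵥ -(H *ᵥ c)) a = coeffVec (R *ᵥ 0) a :=
      coeffVec_mulVec_congr R fun b hb => funext fun i =>
        (coeff_neg _ _).trans (neg_eq_zero.2 (congrFun (hc b (hb.trans_lt ha)) i))
    rw [coeffVec_add, hlow, mulVec_zero]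
    exact add_zero _

theorem exists_mulVec_eq_zero_truncWeight_le [DecidableEq F] {R : Matrix (Fin n) (Fin m) F[X]}
    (hR : H * R = 1) {s : Finset (Fin n)}
    (hs : ∀ u : Fin m → F, ∃ w, (∀ l ∉ s, w l = 0) ∧ coeffMatrix H 0 *ᵥ w = u)
    {l₀ : Fin n} (hl₀ : l₀ ∉ s) (j : ℕ) :
    ∃ v : Fin n → F[X], H *ᵥ v = 0 ∧ coeffVec v 0 ≠ 0 ∧ truncWeight j v ≤ #s * (j + 1) + 1 := by
  let c : Fin n → F[X] := fun l => C ((Pi.single l₀ 1 : Fin n → F) l)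
  have hcl₀ : coeffSupport c ⊆ {(0, l₀)} := by
    rw [← singleton_product_singleton, ← one_smul F[X] c, ← pow_zero X]
    exact coeffSupport_X_pow_smul_C_subset
      (fun l hl => Pi.single_eq_of_ne (mt mem_singleton.2 hl) _) 0
  obtain ⟨g, hg, hcg⟩ := exists_coeffVec_mulVec_add_eq_zero hs (c := c) (j + 1).zero_le
    fun a ha => (a.not_lt_zero ha).elim
  obtain ⟨v, hv, hvcg⟩ := exists_mulVec_eq_zero_coeffVec_eq hR hcg
  refine ⟨v, hv, fun hv₀ => ?_, ?_⟩
  · have hgl₀ : coeffVec g 0 l₀ = 0 :=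
      notMem_coeffSupport (p := (0, l₀)).1 fun hmem => hl₀ (mem_product.1 (hg hmem)).2
    have hone : coeffVec (c + g) 0 l₀ = 1 := by
      rw [coeffVec_add, Pi.add_apply, hgl₀, coeffVec_C, if_pos rfl, Pi.single_eq_same, add_zero]
    rw [← hvcg 0 j.succ_pos, hv₀] at hone
    exact zero_ne_one hone
  · calc truncWeight j v = truncWeight j (c + g) :=
        sum_congr rfl fun a ha => by rw [hvcg a (mem_range.1 ha)]
      _ ≤ #(coeffSupport (c + g)) := by
        rw [truncWeight_eq_card_filter]
        exact card_filter_le _ _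
      _ ≤ #({(0, l₀)} ∪ Ico 0 (j + 1) ×ˢ s) :=
        card_le_card ((coeffSupport_add_subset c g).trans (union_subset_union hcl₀ hg))
      _ ≤ 1 + (j + 1) * #s := by
        simpa using card_union_le {(0, l₀)} (Ico 0 (j + 1) ×ˢ s)
      _ = #s * (j + 1) + 1 := by ring

theorem MinorCriterion.eq_zero_of_coeffSupport_subset_of_le {L N : ℕ} (hH : MinorCriterion H L)
    (hmn : m ≤ n) (hN : N ≤ L + 1) {T : Finset (ℕ × Fin n)} (hT : IsAdmissible m N T)
    {c : Fin n → F[X]} (hcT : coeffSupport c ⊆ T) (hc : ∀ a < N, coeffVec (H *ᵥ c) a = 0) :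
    c = 0 := by
  obtain ⟨s, -, rfl⟩ := exists_subset_card_eq (s := (univ : Finset (Fin n))) (by simpa using hmn)
  obtain ⟨g, hg, hcg⟩ := exists_coeffVec_mulVec_add_eq_zero
    (hH.exists_coeffMatrix_zero_mulVec_eq rfl) hN hc
  have hsum : c + g = 0 := hH.eq_zero_of_coeffSupport_subset (hT.union_Ico_product hN)
    ((coeffSupport_add_subset c g).trans (union_subset_union hcT hg)) hcg
  refine funext fun l => Polynomial.ext fun b => ?_
  by_contra hne
  have hbN : b < N := hT.fst_lt (hcT (mem_coeffSupport (p := (b, l)).2 hne))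
  have hgb : coeffVec g b l = 0 := notMem_coeffSupport (p := (b, l)).1 fun hmem =>
    (mem_Ico.1 (mem_product.1 (hg hmem)).1).1.not_gt hbN
  have hcgb : coeffVec (c + g) b l = 0 := by
    rw [hsum]
    rfl
  rw [coeffVec_add, Pi.add_apply, hgb, add_zero] at hcgb
  exact hne hcgb

theorem MinorCriterion.lt_truncWeight [DecidableEq F] {L j : ℕ} (hH : MinorCriterion H L)
    (hmn : m ≤ n) (hj : j ≤ L) {v : Fin n → F[X]} (hv : H *ᵥ v = 0) (hv₀ : coeffVec v 0 ≠ 0) :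
    m * (j + 1) < truncWeight j v := by
  induction j using Nat.strong_induction_on with
  | _ j ih =>
    by_contra! hle
    -- By induction the shorter truncations are heavy, so the light truncation `c` of `v` is
    -- supported on an admissible set.
    obtain ⟨c, hcv, hc⟩ := exists_coeffSupport_eq_filter v (j + 1)
    obtain ⟨T, hT, hvT⟩ := exists_isAdmissible_of_truncWeight_le hmn hle fun i hi =>
      (ih i hi (hi.le.trans hj)).le
    have hHc : ∀ a < j + 1, coeffVec (H *ᵥ c) a = 0 := fun a ha => by
      rw [coeffVec_mulVec_congr H fun b hb => hc b (hb.trans_lt ha), hv]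
      rfl
    have hc₀ : c = 0 :=
      hH.eq_zero_of_coeffSupport_subset_of_le hmn (Nat.succ_le_succ hj) hT
        (hcv.trans_subset hvT) hHc
    rw [← hc 0 j.succ_pos, hc₀] at hv₀
    exact hv₀ rfl

theorem MinorCriterion.columnDistance_eq [DecidableEq F] {L j : ℕ} (hH : MinorCriterion H L)
    (hmn : m < n) (hj : j ≤ L) {R : Matrix (Fin n) (Fin m) F[X]} (hR : H * R = 1)
    {C : Submodule F[X] (Fin n → F[X])} (hC : IsParityCheckMatrix H C) :
    columnDistance C j = m * (j + 1) + 1 := by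
  obtain ⟨s, -, hs⟩ := exists_subset_card_eq (s := (univ : Finset (Fin n))) (by simpa using hmn.le)
  obtain ⟨l₀, hl₀⟩ : ∃ l₀, l₀ ∉ s := by
    by_contra! hmem
    rw [eq_univ_of_forall hmem, card_univ, Fintype.card_fin] at hs
    exact hmn.ne' hs
  obtain ⟨v, hv, hv₀, hle⟩ := exists_mulVec_eq_zero_truncWeight_le hR
    (hH.exists_coeffMatrix_zero_mulVec_eq hs) hl₀ j
  have hmem : truncWeight j v ∈ {w | ∃ v ∈ C, coeffVec v 0 ≠ 0 ∧ truncWeight j v = w} :=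
    ⟨v, (hC v).2 hv, hv₀, rfl⟩
  refine le_antisymm ((Nat.sInf_le hmem).trans (hs ▸ hle)) (le_csInf ⟨_, hmem⟩ ?_)
  rintro _ ⟨v', hv', hv'₀, rfl⟩
  exact hH.lt_truncWeight hmn.le hj ((hC v').1 hv') hv'₀

end ColumnDistance

section Degree

variable {F : Type*} [Field F] {m n k : ℕ} {H : Matrix (Fin m) (Fin n) F[X]}

theorem isLeftPrime_of_right_inverse {R : Matrix (Fin n) (Fin m) F[X]} (hR : H * R = 1) :
    IsLeftPrime H := by
  rintro M H' rfl
  exact IsUnit.of_mul_eq_one (H' * R) (by rw [← Matrix.mul_assoc, hR])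

theorem isParityCheckMatrix_ker (H : Matrix (Fin m) (Fin n) F[X]) :
    IsParityCheckMatrix H H.mulVecLin.ker := fun _ => LinearMap.mem_ker

theorem exists_isGeneratorMatrix {C : Submodule F[X] (Fin n → F[X])}
    (hC : Module.finrank F[X] C = k) :
    ∃ G : Matrix (Fin k) (Fin n) F[X], IsGeneratorMatrix G C := by
  let b := Module.finBasisOfFinrankEq F[X] C hC
  refine ⟨Matrix.of fun i => (b i : Fin n → F[X]), ?_, ?_⟩
  · exact b.linearIndependent.map' C.subtype C.ker_subtype
  · have hspan := congrArg (Submodule.map C.subtype) b.span_eq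
    rw [Submodule.map_span, Submodule.map_top, Submodule.range_subtype, ← Set.range_comp] at hspan
    exact hspan

theorem IsParityCheckMatrix.exact {C : Submodule F[X] (Fin n → F[X])}
    (hC : IsParityCheckMatrix H C) {G : Matrix (Fin k) (Fin n) F[X]} (hG : IsGeneratorMatrix G C) :
    Function.Exact Gᵀ.mulVec H.mulVec := fun c => by
  rw [← hC, ← hG.2]
  change c ∈ Submodule.span F[X] (Set.range Gᵀ.col) ↔ _
  rw [← range_mulVecLin]
  rfl

theorem exists_sum_equiv_orderEmbedding {a b : ℕ} {f : Fin a → Fin n} (hf : f.Injective)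
    (hn : a + b = n) :
    ∃ (e : Fin a ⊕ Fin b ≃ Fin n) (t : Fin b ↪o Fin n), e ∘ Sum.inl = f ∧ e ∘ Sum.inr = t := by
  have hcard : #(univ.image f)ᶜ = b := by
    rw [card_compl, card_image_of_injective _ hf, card_univ, Fintype.card_fin, Fintype.card_fin]
    omega
  let t := (univ.image f)ᶜ.orderEmbOfFin hcard
  have hinj : (Sum.elim f t).Injective := hf.sumElim t.injective fun i j hij =>
    mem_compl.1 (orderEmbOfFin_mem _ hcard j) (hij ▸ mem_image_of_mem f (mem_univ i))
  have hbij : (Sum.elim f t).Bijective := by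
    rw [Fintype.bijective_iff_injective_and_card]
    exact ⟨hinj, by simpa using hn⟩
  exact ⟨Equiv.ofBijective _ hbij, t, rfl, rfl⟩

theorem natDegree_eq_of_associated {p q : F[X]} (h : Associated p q) :
    p.natDegree = q.natDegree :=
  natDegree_eq_of_degree_eq (degree_eq_degree_of_associated h)

theorem maxMinorDegree_eq {ν : ℕ} (hn : m + k = n) (hdeg : ∀ i l, (H i l).natDegree ≤ ν)
    (hsurj : Function.Surjective (coeffMatrix H ν).mulVec) {R : Matrix (Fin n) (Fin m) F[X]}
    (hR : H * R = 1) {G : Matrix (Fin k) (Fin n) F[X]}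
    (hG : Function.Exact Gᵀ.mulVec H.mulVec) : maxMinorDegree G = m * ν := by
  refine le_antisymm (Finset.sup_le fun t _ => ?_) ?_
  · obtain ⟨e, -, het, -⟩ := exists_sum_equiv_orderEmbedding t.injective ((add_comm k m).trans hn)
    have hassoc := associated_det_submatrix_of_exact hR hG ((Equiv.sumComm _ _).trans e)
    have hcomp : ((Equiv.sumComm _ _).trans e) ∘ Sum.inr = t := het
    rw [hcomp] at hassoc
    rw [← natDegree_eq_of_associated hassoc]
    exact (natDegree_det_le fun i l => hdeg i _).trans_eq (by rw [Fintype.card_fin])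
  · obtain ⟨f, hf, hunit⟩ := exists_injective_isUnit_submatrix hsurj
    obtain ⟨e, t, hef, het⟩ := exists_sum_equiv_orderEmbedding hf hn
    have hassoc := associated_det_submatrix_of_exact hR hG e
    rw [hef, het] at hassoc
    have hcoeff : (H.submatrix id f).det.coeff (m * ν) ≠ 0 := by
      have hdet := coeff_det_of_natDegree_le (A := H.submatrix id f) fun i l => hdeg i _
      rw [Fintype.card_fin] at hdet
      rw [hdet]
      exact ((isUnit_iff_isUnit_det _).1 hunit).ne_zero
    calc m * ν ≤ (H.submatrix id f).det.natDegree := le_natDegree_of_ne_zero hcoeff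
      _ = (G.submatrix id t).det.natDegree := natDegree_eq_of_associated hassoc
      _ ≤ maxMinorDegree G :=
        le_sup (f := fun t : Fin k ↪o Fin n => (G.submatrix id t).det.natDegree) (mem_univ t)

theorem isConvolutionalCode_ker {ν : ℕ} (hn : m + k = n) (hdeg : ∀ i l, (H i l).natDegree ≤ ν)
    (hsurj : Function.Surjective (coeffMatrix H ν).mulVec) {R : Matrix (Fin n) (Fin m) F[X]}
    (hR : H * R = 1) : IsConvolutionalCode n k (m * ν) H.mulVecLin.ker := by
  have hrank : Module.finrank F[X] H.mulVecLin.ker = k := by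
    have hsum := finrank_ker_mulVecLin_add_card
      (mulVec_surjective_iff_exists_right_inverse.2 ⟨R, hR⟩)
    rw [Fintype.card_fin, Fintype.card_fin] at hsum
    omega
  exact ⟨hrank, exists_isGeneratorMatrix hrank, fun G hG =>
    maxMinorDegree_eq hn hdeg hsurj hR ((isParityCheckMatrix_ker H).exact hG)⟩

theorem rowDegree_eq {ν : ℕ} (hdeg : ∀ i l, (H i l).natDegree ≤ ν)
    (hsurj : Function.Surjective (coeffMatrix H ν).mulVec) (i : Fin m) : rowDegree H i = ν := by
  refine le_antisymm (Finset.sup_le fun l _ => hdeg i l) ?_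
  obtain ⟨w, hw⟩ := hsurj 1
  have hsum : ∑ l, (H i l).coeff ν * w l ≠ 0 :=
    ((congrFun hw i).trans_ne (one_ne_zero : (1 : F) ≠ 0))
  obtain ⟨l, -, hl⟩ := exists_ne_zero_of_sum_ne_zero hsum
  exact (le_natDegree_of_ne_zero (left_ne_zero_of_mul hl)).trans
    (le_sup (f := fun l => (H i l).natDegree) (mem_univ l))

end Degree

theorem div_add_div_add_one_mul_sub_le {n k δ : ℕ} (hk : 0 < k) (hkn : k ≤ n)
    (hdvd : (n - k) ∣ δ) : (δ / k + δ / (n - k) + 1) * (n - k) ≤ (δ / k + 1) * n := by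
  calc (δ / k + δ / (n - k) + 1) * (n - k) = (δ / k + 1) * (n - k) + δ := by
        rw [add_right_comm, add_mul, Nat.div_mul_cancel hdvd]
    _ ≤ (δ / k + 1) * (n - k) + (δ / k + 1) * k :=
        Nat.add_le_add_left (mul_comm k _ ▸ (Nat.lt_mul_div_succ δ hk).le) _
    _ = (δ / k + 1) * n := by rw [← mul_add, Nat.sub_add_cancel hkn]

end ConvCode

theorem mainTheorem2_general {F : Type*} [Field F] [DecidableEq F] (n k δ : ℕ)
    (hk : 0 < k) (hkn : k < n) (hdvd : (n - k) ∣ δ)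
    (H : Matrix (Fin (n - k)) (Fin n) (Polynomial F))
    (hdeg : ∀ i l, (H i l).natDegree ≤ δ / (n - k))
    (hH : ConvCode.MinorCriterion H (δ / k + δ / (n - k))) :
    ConvCode.IsLeftPrime H ∧
      ∃ C : Submodule (Polynomial F) (Fin n → Polynomial F),
        ConvCode.IsParityCheckMatrix H C ∧ ConvCode.IsMDP n k δ C ∧
          δ = ∑ i, ConvCode.rowDegree H i := by
  have hν : (n - k) * (δ / (n - k)) = δ := Nat.mul_div_cancel' hdvd
  have hle := ConvCode.div_add_div_add_one_mul_sub_le hk hkn.le hdvd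
  obtain ⟨R, hR⟩ := hH.exists_right_inverse hdeg hle
  have hsurj := hH.coeffMatrix_mulVec_surjective hdeg hle
  have hC := ConvCode.isParityCheckMatrix_ker H
  have hcode := ConvCode.isConvolutionalCode_ker (Nat.sub_add_cancel hkn.le) hdeg hsurj hR
  rw [hν] at hcode
  refine ⟨ConvCode.isLeftPrime_of_right_inverse hR, H.mulVecLin.ker, hC, ⟨hcode, fun j hj =>
    hH.columnDistance_eq (by omega) hj hR hC⟩, ?_⟩
  simp only [ConvCode.rowDegree_eq hdeg hsurj, Finset.sum_const, Finset.card_univ,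
    Fintype.card_fin, smul_eq_mul, hν]

theorem mainTheorem2 {F : Type*} [Field F] [Finite F] [DecidableEq F] (n k δ : ℕ)
    (hk : 0 < k) (hkn : k < n) (hdvd : (n - k) ∣ δ)
    (H : Matrix (Fin (n - k)) (Fin n) (Polynomial F))
    (hdeg : ∀ i l, (H i l).natDegree ≤ δ / (n - k))
    (hH : ConvCode.MinorCriterion H (δ / k + δ / (n - k))) :
    ConvCode.IsLeftPrime H ∧
      ∃ C : Submodule (Polynomial F) (Fin n → Polynomial F),
        ConvCode.IsParityCheckMatrix H C ∧ ConvCode.IsMDP n k δ C ∧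
          δ = ∑ i, ConvCode.rowDegree H i :=
  mainTheorem2_general n k δ hk hkn hdvd H hdeg hH
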